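/- For $\lambda\in\{-1,-2\}$ let $\phi_\lambda:[0,1]\to[0,\infty]$ be the power-divergence function, $$\phi_{-1}(x)=x-1-\log x,\qquad \phi_{-2}(x)=\tfrac12\left(x^{-1}-x-2(1-x)\right)\quad(0<x\le 1),\qquad \phi_\lambda(0)=\infty$$ (these are the members $\lambda=-1,-2$ of the family $\phi_\lambda(x)=\frac{x^{\lambda+1}-x+\lambda(1-x)}{\lambda(\lambda+1)}$ for $\lambda\ne-1,0$, with $\phi_{-1}$ the limit as $\lambda\to-1$). For these two values of $\lambda$, $\phi_\lambda$ is a bijection of $[0,1]$ onto $[0,\infty]$; let $\phi_\lambda^{-1}:[0,\infty]\to[0,1]$ be its inverse (so $\phi_\lambda^{-1}(\infty)=0$). Then, for every integer $d\ge 3$, the two functions $$C_{-1}(u_1,\dots,u_d)=\phi_{-1}^{-1}\left(\phi_{-1}(u_1)+\cdots+\phi_{-1}(u_d)\right),\qquad C_{-2}(u_1,\dots,u_d)=\phi_{-2}^{-1}\left(\phi_{-2}(u_1)+\cdots+\phi_{-2}(u_d)\right),$$ where $u_1,\dots,u_d\in[0,1]$, are copulas: for each $\lambda\in\{-1,-2\}$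 there is a random vector $(U_1,\dots,U_d)$, each $U_j$ being uniformly distributed on $[0,1]$, such that $C_\lambda(u_1,\dots,u_d)=\Pr(U_1\le u_1,\dots,U_d\le u_d)$ for all $u_1,\dots,u_d\in[0,1]$. -/

import Mathlib

open MeasureTheory Set

/-- A function `C` on `[0,1]^d` is a `d`-variate copula if it is the restriction to `[0,1]^d` of the
joint CDF of a random vector, with law `μ`, whose coordinates are uniformly distributed on
`[0,1]`. (Values of `C` outside `[0,1]^d` are irrelevant.) -/
def IsCopula {d : ℕ} (C : (Fin d → ℝ) → ℝ) : Prop :=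
  ∃ μ : Measure (Fin d → ℝ), IsProbabilityMeasure μ ∧
    (∀ j : Fin d, pdf.IsUniform (fun x : Fin d → ℝ => x j) (Icc (0 : ℝ) 1) μ volume) ∧
    ∀ u : Fin d → ℝ, (∀ j, u j ∈ Icc (0 : ℝ) 1) → C u = μ.real {x | ∀ j, x j ≤ u j}

/-- The closed formula for the power-divergence function at a point `x > 0`. -/
noncomputable def powerDivFormula (lam x : ℝ) : ℝ :=
  if lam = -1 then x - 1 - Real.log x
  else if lam = 0 then 1 - x + x * Real.log x
  else 1 / (lam * (lam + 1)) * (x ^ (lam + 1) - x + lam * (1 - x))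

/-- The power-divergence function `φ_λ`, with values in the extended reals: `φ_λ 0 = ∞` when
`λ ≤ -1`. (When `λ > -1` the formula itself gives `φ_λ 0 = 1 / (λ + 1)`.) -/
noncomputable def powerDiv (lam x : ℝ) : EReal :=
  if lam ≤ -1 ∧ x = 0 then ⊤ else (powerDivFormula lam x : EReal)

/-- The inverse `φ_λ⁻¹` of `φ_λ` restricted to `[0,1]`. For `λ = -1` and `λ = -2` this is a genuine
two-sided inverse defined on all of `[0,∞]`; see `powerDiv_neg_one_bijOn` and
`powerDiv_neg_two_bijOn`. -/
noncomputable def powerDivInv (lam : ℝ) : EReal → ℝ :=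
  Function.invFunOn (powerDiv lam) (Icc 0 1)

/-- The `d`-variate function `C_λ(u₁, …, u_d) = φ_λ⁻¹(φ_λ(u₁) + ⋯ + φ_λ(u_d))`. -/
noncomputable def powerDivCopula (lam : ℝ) {d : ℕ} (u : Fin d → ℝ) : ℝ :=
  powerDivInv lam (∑ j, powerDiv lam (u j))

theorem powerDiv_bijOn_of {lam : ℝ} (hl : lam ≤ -1)
    (hanti : StrictAntiOn (powerDivFormula lam) (Ioc 0 1))
    (hcont : ContinuousOn (powerDivFormula lam) (Ioc 0 1))
    (hone : powerDivFormula lam 1 = 0)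
    (hlarge : ∀ t : ℝ, 0 ≤ t → ∃ x ∈ Ioc (0 : ℝ) 1, t ≤ powerDivFormula lam x) :
    BijOn (powerDiv lam) (Icc 0 1) (Ici 0) := by
  have hz : powerDiv lam 0 = ⊤ := by simp [powerDiv, hl]
  have hp : ∀ x : ℝ, 0 < x → powerDiv lam x = (powerDivFormula lam x : EReal) := by
    intro x hx
    simp [powerDiv, hx.ne']
  refine ⟨?_, ?_, ?_⟩
  · intro x hx
    rcases hx.1.eq_or_lt with h | h
    · rw [← h, hz]; exact (le_top : (0 : EReal) ≤ ⊤)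
    · rw [hp x h]
      have := hanti.antitoneOn (a := x) (b := 1) ⟨h, hx.2⟩ (by simp) hx.2
      rw [hone] at this
      exact EReal.coe_nonneg.2 this
  · intro x hx y hy hxy
    rcases hx.1.eq_or_lt with h | h <;> rcases hy.1.eq_or_lt with h' | h'
    · rw [← h, ← h']
    · rw [← h, hz, hp y h'] at hxy
      exact absurd hxy.symm (EReal.coe_ne_top _)
    · rw [← h', hz, hp x h] at hxy
      exact absurd hxy (EReal.coe_ne_top _)
    · rw [hp x h, hp y h', EReal.coe_eq_coe_iff] at hxy
      exact hanti.injOn ⟨h, hx.2⟩ ⟨h', hy.2⟩ hxy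
  · intro t ht
    induction t with
    | bot => simp at ht
    | top => exact ⟨0, by simp, hz⟩
    | coe t =>
      have ht0 : 0 ≤ t := EReal.coe_nonneg.1 ht
      obtain ⟨x, hx, hxt⟩ := hlarge t ht0
      have hsub : Icc x 1 ⊆ Ioc (0 : ℝ) 1 := fun y hy => ⟨hx.1.trans_le hy.1, hy.2⟩
      obtain ⟨y, hy, hyt⟩ := intermediate_value_Icc' hx.2 (hcont.mono hsub)
        (show t ∈ Icc (powerDivFormula lam 1) (powerDivFormula lam x) from ⟨hone ▸ ht0, hxt⟩)
      have hy' := hsub hy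
      exact ⟨y, ⟨hy'.1.le, hy'.2⟩, by rw [hp y hy'.1, hyt]⟩

/-- `φ_{-1}` is a bijection from `[0,1]` onto `[0,∞]`. -/
theorem powerDiv_neg_one_bijOn : BijOn (powerDiv (-1)) (Icc 0 1) (Ici 0) := by
  have hf : ∀ x, powerDivFormula (-1) x = x - 1 - Real.log x := by
    intro x; simp [powerDivFormula]
  apply powerDiv_bijOn_of le_rfl
  · intro x hx y hy hxy
    simp only [hf]
    have h1 : Real.log (x / y) < x / y - 1 :=
      Real.log_lt_sub_one_of_pos (div_pos hx.1 hy.1) (by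
        rw [Ne, div_eq_one_iff_eq hy.1.ne']; exact hxy.ne)
    rw [Real.log_div hx.1.ne' hy.1.ne'] at h1
    have h2 : y - x ≤ 1 - x / y := by
      rw [show 1 - x / y = (y - x) / y by field_simp [hy.1.ne'], le_div_iff₀ hy.1]
      nlinarith [hy.2]
    linarith
  · simp only [funext hf]
    exact (continuousOn_id.sub continuousOn_const).sub
      (Real.continuousOn_log.mono fun x hx => hx.1.ne')
  · simp [hf]
  · intro t ht
    refine ⟨Real.exp (-(t + 1)), ⟨Real.exp_pos _, Real.exp_le_one_iff.2 (by linarith)⟩, ?_⟩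
    rw [hf, Real.log_exp]
    linarith [Real.exp_pos (-(t + 1))]

/-- `φ_{-2}` is a bijection from `[0,1]` onto `[0,∞]`. -/
theorem powerDiv_neg_two_bijOn : BijOn (powerDiv (-2)) (Icc 0 1) (Ici 0) := by
  have hf : ∀ x, powerDivFormula (-2) x = (x⁻¹ + x - 2) / 2 := by
    intro x
    have h : ((-2 : ℝ) + 1) = -1 := by norm_num
    rw [powerDivFormula, if_neg (by norm_num), if_neg (by norm_num), h, Real.rpow_neg_one]
    ring
  apply powerDiv_bijOn_of (by norm_num)
  · intro x hx y hy hxy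
    simp only [hf]
    have h1 : y - x < x⁻¹ - y⁻¹ := by
      rw [inv_sub_inv hx.1.ne' hy.1.ne', lt_div_iff₀ (mul_pos hx.1 hy.1)]
      have : x * y < 1 := by nlinarith [hx.1, hx.2, hy.1, hy.2]
      nlinarith
    linarith
  · simp only [funext hf]
    exact (((continuousOn_inv₀.mono fun x hx => hx.1.ne').add continuousOn_id).sub
      continuousOn_const).div_const 2
  · simp [hf]; norm_num
  · intro t ht
    have hpos : (0 : ℝ) < 2 * t + 2 := by linarith
    refine ⟨(2 * t + 2)⁻¹, ⟨inv_pos.2 hpos, inv_le_one_of_one_le₀ (by linarith)⟩, ?_⟩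
    rw [hf, inv_inv]
    linarith [inv_pos.2 hpos]

/-!
For `λ = -1` and `λ = -2` the inverse `ψ` of `φ_λ` is the Laplace transform of a probability measure
on `(0, ∞)`, and such a `ψ` generates Archimedean copulas in every dimension.

Solving `φ_λ(y) = t` amounts to solving a fixed point equation `y = k(t) * h(y)`, where `k` is the
Laplace transform of a probability measure `K` on `[0, ∞)` and `h` is a probability generating
function:
* for `λ = -1`, `y = exp (-t) * exp (y - 1)`, with `K` the point mass at `1` and `h` of Poisson type;
* for `λ = -2`, `y = (1 + t)⁻¹ * ((1 + y ^ 2) / 2)`, with `K` exponential and `h` that of critical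
  binary branching.

This is the equation for the Laplace transform of the total weight of a critical branching process
with offspring law `h` and independent individual weights of law `K`. It is solved by iterating
`y ↦ k * h(y)` from `0`. Laplace transforms of measures are closed under sums and products, so the
increments of the iteration are Laplace transforms (`IsLaplace.genFun_add`), and so is the sum of
all increments, which is the limit (`exists_laplace_eq_mul_genFun`). No explicit coefficients and
no characterization of completely monotone functions are needed.

If `M` has Laplace transform `ψ` and the `E_j` are independent standard exponential variables,
independent of `M`, then the vector `(ψ (E_1 / M), …, ψ (E_d / M))` has distribution function
`ψ (∑ ψ⁻¹(u_j))`, by conditioning on `M` (`isCopula_of_laplace`).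
-/

open ProbabilityTheory
open scoped ENNReal

/-! ### Laplace transforms of measures on the real line -/

/-- The Laplace transform of a measure on `ℝ`, with values in `[0, ∞]`. No condition is put on the
support of the measure or on its total mass. -/
noncomputable def laplace (G : Measure ℝ) (t : ℝ) : ℝ≥0∞ :=
  ∫⁻ m, ENNReal.ofReal (Real.exp (-(t * m))) ∂G

/-- A function is a Laplace transform if it is that of some s-finite measure. This is the measure
theoretic form of complete monotonicity, and s-finiteness is what convolutions need. -/
def IsLaplace (f : ℝ → ℝ≥0∞) : Prop :=
  ∃ G : Measure ℝ, SFinite G ∧ ∀ t, f t = laplace G t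

theorem isLaplace_laplace (G : Measure ℝ) [SFinite G] : IsLaplace (laplace G) :=
  ⟨G, inferInstance, fun _ => rfl⟩

theorem isLaplace_const (c : ℝ≥0∞) : IsLaplace fun _ => c :=
  ⟨c • Measure.dirac 0, inferInstance, fun t => by simp [laplace]⟩

theorem IsLaplace.add {f g : ℝ → ℝ≥0∞} (hf : IsLaplace f) (hg : IsLaplace g) :
    IsLaplace fun t => f t + g t := by
  obtain ⟨F, hF, hf⟩ := hf
  obtain ⟨G, hG, hg⟩ := hg
  exact ⟨F + G, inferInstance, fun t => by
    simp only [hf, hg, laplace, lintegral_add_measure]⟩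

theorem IsLaplace.tsum {f : ℕ → ℝ → ℝ≥0∞} (hf : ∀ n, IsLaplace (f n)) :
    IsLaplace fun t => ∑' n, f n t := by
  choose F hF hf using hf
  exact ⟨Measure.sum F, inferInstance, fun t => by
    rw [laplace, lintegral_sum_measure]
    exact tsum_congr fun n => hf n t⟩

theorem IsLaplace.mul {f g : ℝ → ℝ≥0∞} (hf : IsLaplace f) (hg : IsLaplace g) :
    IsLaplace fun t => f t * g t := by
  obtain ⟨F, hF, hf⟩ := hf
  obtain ⟨G, hG, hg⟩ := hg
  refine ⟨F.conv G, inferInstance, fun t => ?_⟩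
  simp only [hf, hg, laplace]
  rw [Measure.lintegral_conv (by fun_prop),
    ← lintegral_mul_const _ (by fun_prop)]
  refine lintegral_congr fun x => ?_
  rw [← lintegral_const_mul _ (by fun_prop)]
  refine lintegral_congr fun y => ?_
  rw [← ENNReal.ofReal_mul (Real.exp_pos _).le, ← Real.exp_add]
  ring_nf

theorem laplace_dirac_one (t : ℝ) :
    laplace (Measure.dirac 1) t = ENNReal.ofReal (Real.exp (-t)) := by
  simp [laplace]

theorem laplace_expMeasure {t : ℝ} (ht : 0 ≤ t) :
    laplace (expMeasure 1) t = ENNReal.ofReal (1 / (1 + t)) := by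
  have h1 : (0 : ℝ) < 1 + t := by linarith
  have hm : ∀ r, Measurable (exponentialPDF r) := fun r =>
    (measurable_exponentialPDFReal r).ennreal_ofReal
  have h2 : expMeasure 1 = volume.withDensity (exponentialPDF 1) := rfl
  rw [laplace, h2, lintegral_withDensity_eq_lintegral_mul _ (hm 1) (by fun_prop)]
  -- The integrand is, up to the factor `1 / (1 + t)`, the exponential density of rate `1 + t`.
  have h3 : ∀ x, (exponentialPDF 1 * fun m => ENNReal.ofReal (Real.exp (-(t * m)))) x
      = ENNReal.ofReal (1 / (1 + t)) * exponentialPDF (1 + t) x := by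
    intro x
    rw [Pi.mul_apply, exponentialPDF_eq, exponentialPDF_eq]
    split_ifs
    · rw [← ENNReal.ofReal_mul (by positivity), ← ENNReal.ofReal_mul (by positivity),
        mul_assoc, ← Real.exp_add, ← mul_assoc, one_div_mul_cancel h1.ne']
      ring_nf
    · simp
  rw [lintegral_congr h3, lintegral_const_mul _ (hm _), lintegral_exponentialPDF_eq_one h1,
    mul_one]

/-! ### Fixed points of probability generating functions -/

/-- The generating function of the sequence `c`, with values in `[0, ∞]`. -/
noncomputable def genFun (c : ℕ → ℝ≥0∞) (x : ℝ≥0∞) : ℝ≥0∞ := ∑' k, c k * x ^ k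

theorem genFun_mono (c : ℕ → ℝ≥0∞) : Monotone (genFun c) := fun x y hxy => by
  unfold genFun
  gcongr

theorem genFun_iSup (c : ℕ → ℝ≥0∞) {y : ℕ → ℝ≥0∞} (hy : Monotone y) :
    genFun c (⨆ n, y n) = ⨆ n, genFun c (y n) := by
  have h : ∀ k, c k * (⨆ n, y n) ^ k = ⨆ n, c k * y n ^ k := by
    intro k
    rcases Nat.eq_zero_or_pos k with rfl | hk
    · simp
    · rw [ENNReal.iSup_pow_of_ne_zero hk.ne', ENNReal.mul_iSup]
  simp only [genFun, h, ← lintegral_count]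
  exact lintegral_iSup (fun _ => Measurable.of_discrete) fun m n hmn k => by
    have := hy hmn
    dsimp only
    gcongr

theorem IsLaplace.pow_add {f δ : ℝ → ℝ≥0∞} (hf : IsLaplace f) (hδ : IsLaplace δ) (k : ℕ) :
    ∃ η, IsLaplace η ∧ IsLaplace (fun t => f t ^ k) ∧ ∀ t, (f t + δ t) ^ k = f t ^ k + η t := by
  induction k with
  | zero => exact ⟨fun _ => 0, isLaplace_const 0, by simpa using isLaplace_const 1, by simp⟩
  | succ k ih =>
    obtain ⟨η, hη, hk, h⟩ := ih
    refine ⟨fun t => η t * f t + (f t ^ k + η t) * δ t,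
      (hη.mul hf).add ((hk.add hη).mul hδ), by simpa only [pow_succ] using hk.mul hf, fun t => ?_⟩
    rw [pow_succ, h]
    ring

/-- An increment of a generating function, between arguments whose difference is a Laplace
transform, is a Laplace transform. -/
theorem IsLaplace.genFun_add {f δ : ℝ → ℝ≥0∞} (hf : IsLaplace f) (hδ : IsLaplace δ)
    (c : ℕ → ℝ≥0∞) :
    ∃ η, IsLaplace η ∧ ∀ t, genFun c (f t + δ t) = genFun c (f t) + η t := by
  choose η hη _ h using fun k => hf.pow_add hδ k
  refine ⟨fun t => ∑' k, c k * η k t, IsLaplace.tsum fun k => (isLaplace_const (c k)).mul (hη k),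
    fun t => ?_⟩
  simp only [genFun, h, mul_add]
  exact ENNReal.tsum_add

/-- If `c` is a probability distribution on `ℕ`, then the equation `x = laplace K t * genFun c x`
has a solution `x = x(t)` that is a Laplace transform in `t`: the law `G` of the total weight of a
branching process with offspring law `c`, whose individuals carry independent weights of law `K`.
Iteration from `0` increases to this solution, and each step adds a Laplace transform. -/
theorem exists_laplace_eq_mul_genFun (K : Measure ℝ) [SFinite K] {c : ℕ → ℝ≥0∞}
    (hc : ∑' k, c k = 1) :
    ∃ G : Measure ℝ, SFinite G ∧ ∀ t, laplace K t ≤ 1 →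
      laplace G t ≤ 1 ∧ laplace G t = laplace K t * genFun c (laplace G t) := by
  let y : ℕ → ℝ → ℝ≥0∞ := fun n => (fun f t => laplace K t * genFun c (f t))^[n] 0
  have y_succ : ∀ n t, y (n + 1) t = laplace K t * genFun c (y n t) := fun n t =>
    congrFun (Function.iterate_succ_apply' _ n _) t
  have hstep : ∀ n, IsLaplace (y n) ∧
      ∃ δ, IsLaplace δ ∧ ∀ t, y (n + 1) t = y n t + δ t := by
    intro n
    induction n with
    | zero =>
      refine ⟨isLaplace_const 0, fun t => laplace K t * genFun c 0,
        (isLaplace_laplace K).mul (isLaplace_const _), fun t => ?_⟩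
      rw [y_succ]
      exact (zero_add _).symm
    | succ n ih =>
      obtain ⟨hy, δ, hδ, h⟩ := ih
      obtain ⟨η, hη, h'⟩ := hy.genFun_add hδ c
      refine ⟨?_, fun t => laplace K t * η t, (isLaplace_laplace K).mul hη, fun t => ?_⟩
      · rw [funext h]
        exact hy.add hδ
      · rw [y_succ (n + 1), h, h', mul_add, ← y_succ, h]
  choose _ δ hδ hyδ using hstep
  obtain ⟨G, hG, h⟩ := IsLaplace.tsum hδ
  have hsum : ∀ n t, y n t = ∑ i ∈ Finset.range n, δ i t := by
    intro n t
    induction n with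
    | zero => rfl
    | succ n ih => rw [hyδ, ih, Finset.sum_range_succ]
  have hsup : ∀ t, laplace G t = ⨆ n, y n t := by
    intro t
    simp only [← h, ENNReal.tsum_eq_iSup_nat, hsum]
  have hmono : ∀ t, Monotone fun n => y n t := fun t =>
    monotone_nat_of_le_succ fun n => by rw [hyδ]; exact le_self_add
  refine ⟨G, hG, fun t ht => ⟨?_, ?_⟩⟩
  · rw [hsup]
    refine iSup_le fun n => ?_
    induction n with
    | zero => exact zero_le
    | succ n ih =>
      rw [y_succ]
      calc laplace K t * genFun c (y n t) ≤ 1 * genFun c 1 := mul_le_mul' ht (genFun_mono c ih)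
        _ = 1 := by simp [genFun, hc]
  · rw [hsup, genFun_iSup c (hmono t), ENNReal.mul_iSup]
    simp only [← y_succ]
    exact ((hmono t).iSup_nat_add 1).symm

/-! ### Archimedean copulas generated by Laplace transforms -/

/-- A probability law on the cube `[0,1]^d` with distribution function `C` makes `C` a copula as
soon as `C` reduces to the identity when all arguments but one equal `1`. -/
theorem isCopula_of_cdf {d : ℕ} {C : (Fin d → ℝ) → ℝ} (μ : Measure (Fin d → ℝ))
    [IsProbabilityMeasure μ] (hμ : ∀ᵐ x ∂μ, ∀ j, x j ∈ Icc (0 : ℝ) 1)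
    (hC : ∀ u : Fin d → ℝ, (∀ j, u j ∈ Icc (0 : ℝ) 1) → C u = μ.real {x | ∀ j, x j ≤ u j})
    (hmarg : ∀ j, ∀ a ∈ Icc (0 : ℝ) 1, C (Function.update (fun _ => 1) j a) = a) :
    IsCopula C := by
  refine ⟨μ, inferInstance, fun j => ?_, hC⟩
  have hmj : Measurable fun x : Fin d → ℝ => x j := measurable_pi_apply j
  have hprob : IsProbabilityMeasure (μ.map fun x : Fin d → ℝ => x j) :=
    Measure.isProbabilityMeasure_map hmj.aemeasurable
  refine Measure.ext_of_Iic _ _ fun a => ?_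
  rw [Measure.map_apply hmj measurableSet_Iic, cond_apply measurableSet_Icc, Real.volume_Icc,
    sub_zero, ENNReal.ofReal_one, inv_one, one_mul]
  have hcap : Icc (0 : ℝ) 1 ∩ Iic a = Icc 0 (min 1 a) := by
    rw [← Ici_inter_Iic, ← Ici_inter_Iic, inter_assoc, Iic_inter_Iic]
  rw [hcap, Real.volume_Icc, sub_zero]
  rcases lt_or_ge a 0 with ha | ha
  · rw [ENNReal.ofReal_of_nonpos ((min_le_right _ _).trans ha.le)]
    refine measure_mono_null (fun x hx => ?_) (ae_iff.1 hμ)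
    exact fun h => (lt_of_le_of_lt hx ha).not_ge (h j).1
  · have hb : min 1 a ∈ Icc (0 : ℝ) 1 := ⟨le_min zero_le_one ha, min_le_left _ _⟩
    have hu : ∀ i, Function.update (fun _ : Fin d => (1 : ℝ)) j (min 1 a) i ∈ Icc (0 : ℝ) 1 := by
      intro i
      rcases eq_or_ne i j with rfl | hij
      · simpa only [Function.update_self] using hb
      · simp [Function.update_of_ne hij]
    have h := hC _ hu
    rw [hmarg j _ hb] at h
    rw [h, measureReal_def, ENNReal.ofReal_toReal (measure_ne_top _ _)]
    refine measure_congr ?_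
    filter_upwards [hμ] with x hx
    refine propext ⟨fun hxa i => ?_, fun hxu => ?_⟩
    · rcases eq_or_ne i j with rfl | hij
      · simpa only [Function.update_self] using le_min (hx i).2 hxa
      · simpa only [Function.update_of_ne hij] using (hx i).2
    · have := hxu j
      rw [Function.update_self] at this
      exact this.trans (min_le_right _ _)

theorem expMeasure_one_setOf_le_max_div {t m : ℝ} (ht : 0 ≤ t) (hm : 0 < m) :
    expMeasure 1 {e | t ≤ max (e / m) 0} = ENNReal.ofReal (Real.exp (-(t * m))) := by
  have hP : IsProbabilityMeasure (expMeasure 1) := isProbabilityMeasure_expMeasure one_pos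
  rcases ht.eq_or_lt with rfl | ht
  · simp
  · have hset : {e : ℝ | t ≤ max (e / m) 0} = Ici (t * m) := by
      ext e
      simp only [mem_ofPred_eq, le_max_iff, ht.not_ge, or_false, mem_Ici, le_div_iff₀ hm]
    have hatom : NullSingletonClass (expMeasure 1) :=
      inferInstanceAs (NullSingletonClass ((volume : Measure ℝ).withDensity (gammaPDF 1 1)))
    have hcdf := cdf_expMeasure_eq one_pos (t * m)
    rw [if_pos (by positivity), cdf_eq_real, one_mul] at hcdf
    rw [hset, measure_congr Ioi_ae_eq_Ici.symm, ← compl_Iic, ← ofReal_measureReal,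
      measureReal_compl measurableSet_Iic, hcdf]
    simp

theorem sum_eq_top_of_nonneg {ι : Type*} [Fintype ι] {f : ι → EReal} (hf : ∀ i, 0 ≤ f i) {j : ι}
    (hj : f j = ⊤) : ∑ i, f i = ⊤ :=
  top_le_iff.1 (hj ▸ Finset.single_le_sum (fun i _ => hf i) (Finset.mem_univ j))

/-- An antitone bijection `φ` of `[0,1]` onto `[0,∞]` whose inverse is, on `[0,∞)`, the Laplace
transform of a measure `G` generates Archimedean copulas in all dimensions. The coordinates
`φ⁻¹ (E_j / M)`, with `M` of law `G` and independent exponential variables `E_j`, have the required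
joint distribution function, since `P (E_j ≥ M s_j for all j | M) = exp (-M ∑ s_j)`. -/
theorem isCopula_of_laplace {φ : ℝ → EReal} (hbij : BijOn φ (Icc 0 1) (Ici 0))
    (hanti : AntitoneOn φ (Icc 0 1)) (h0 : φ 0 = ⊤) (G : Measure ℝ) [SFinite G]
    (hG : ∀ t : ℝ, 0 ≤ t →
      laplace G t = ENNReal.ofReal (Function.invFunOn φ (Icc 0 1) (t : EReal)))
    (d : ℕ) :
    IsCopula fun u : Fin d → ℝ => Function.invFunOn φ (Icc 0 1) (∑ j, φ (u j)) := by
  set inv := Function.invFunOn φ (Icc (0 : ℝ) 1)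
  have inv_mem : ∀ s, 0 ≤ s → inv s ∈ Icc (0 : ℝ) 1 := fun s hs =>
    Function.invFunOn_mem (hbij.surjOn hs)
  have φ_inv : ∀ s, 0 ≤ s → φ (inv s) = s := fun s hs =>
    Function.invFunOn_eq (hbij.surjOn hs)
  have inv_φ : ∀ x ∈ Icc (0 : ℝ) 1, inv (φ x) = x := fun x hx =>
    hbij.injOn (inv_mem _ (hbij.mapsTo hx)) hx (φ_inv _ (hbij.mapsTo hx))
  have h1 : φ 1 = 0 := by
    refine le_antisymm ?_ (hbij.mapsTo (by simp))
    obtain ⟨x, hx, hx0⟩ := hbij.surjOn (mem_Ici.2 (le_refl (0 : EReal)))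
    exact hx0 ▸ hanti hx (by simp) hx.2
  have φ_real : ∀ x ∈ Ioc (0 : ℝ) 1, ∃ t : ℝ, 0 ≤ t ∧ φ x = t := by
    intro x hx
    have hx' : x ∈ Icc (0 : ℝ) 1 := ⟨hx.1.le, hx.2⟩
    have hpos : 0 ≤ φ x := hbij.mapsTo hx'
    have htop : φ x ≠ ⊤ := fun h =>
      hx.1.ne' (hbij.injOn hx' (by simp) (h.trans h0.symm))
    lift φ x to ℝ using ⟨htop, (EReal.bot_lt_zero.trans_le hpos).ne'⟩ with t ht
    exact ⟨t, EReal.coe_nonneg.1 hpos, rfl⟩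
  have hprob : IsProbabilityMeasure G := ⟨by
    have h := hG 0 le_rfl
    rw [EReal.coe_zero, ← h1, inv_φ 1 (by simp)] at h
    simpa [laplace] using h⟩
  -- The mixing variable is positive because the Laplace transform vanishes at infinity.
  have hGpos : ∀ᵐ m ∂G, 0 < m := by
    have hle : ∀ x ∈ Ioc (0 : ℝ) 1, G (Iic 0) ≤ ENNReal.ofReal x := by
      intro x hx
      obtain ⟨t, ht, hxt⟩ := φ_real x hx
      calc G (Iic 0) = ∫⁻ m in Iic 0, 1 ∂G := by simp
        _ ≤ ∫⁻ m in Iic 0, ENNReal.ofReal (Real.exp (-(t * m))) ∂G := by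
          refine setLIntegral_mono (by fun_prop) fun m hm => ?_
          rw [← ENNReal.ofReal_one]
          exact ENNReal.ofReal_le_ofReal
            (Real.one_le_exp (neg_nonneg.2 (mul_nonpos_of_nonneg_of_nonpos ht hm)))
        _ ≤ laplace G t := setLIntegral_le_lintegral _ _
        _ = ENNReal.ofReal x := by rw [hG t ht, ← hxt, inv_φ x ⟨hx.1.le, hx.2⟩]
    have hzero : G (Iic 0) = 0 := by
      by_contra hne
      obtain ⟨x, hx0, hx⟩ := ENNReal.lt_iff_exists_real_btwn.1 (pos_iff_ne_zero.2 hne)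
      have hx' : 0 < x := ENNReal.ofReal_pos.1 hx.1
      refine (hx.2.trans_le (hle (min x 1) ⟨lt_min hx' one_pos, min_le_right _ _⟩)).not_ge ?_
      exact ENNReal.ofReal_le_ofReal (min_le_left _ _)
    have hcompl : {m : ℝ | ¬0 < m} = Iic 0 := by
      ext m
      simp
    rwa [ae_iff, hcompl]
  -- The inverse on the real half line, extended to all of `ℝ` so as to be monotone.
  set ψ : ℝ → ℝ := fun s => inv ((max s 0 : ℝ) : EReal) with hψ
  have hmax : ∀ s : ℝ, (0 : EReal) ≤ ((max s 0 : ℝ) : EReal) := fun s =>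
    EReal.coe_nonneg.2 (le_max_right _ _)
  have ψ_le : ∀ s, ∀ u ∈ Icc (0 : ℝ) 1, ψ s ≤ u ↔ φ u ≤ ((max s 0 : ℝ) : EReal) := by
    intro s u hu
    constructor
    · intro h
      rw [← φ_inv _ (hmax s)]
      exact hanti (inv_mem _ (hmax s)) hu h
    · intro h
      by_contra! hlt
      have h' := hanti hu (inv_mem _ (hmax s)) hlt.le
      rw [φ_inv _ (hmax s)] at h'
      exact hlt.ne (by rw [hψ]; dsimp only; rw [← le_antisymm h h', inv_φ u hu])
  have ψ_pos : ∀ s, 0 < ψ s := fun s => by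
    by_contra! h
    have := (ψ_le s 0 (by simp)).1 h
    rw [h0, top_le_iff] at this
    exact EReal.coe_ne_top _ this
  have ψ_meas : Measurable ψ := by
    refine Antitone.measurable fun s s' hss => ?_
    rw [ψ_le s' _ (inv_mem _ (hmax s)), φ_inv _ (hmax s)]
    exact EReal.coe_le_coe_iff.2 (max_le_max_right 0 hss)
  have hE : IsProbabilityMeasure (expMeasure 1) := isProbabilityMeasure_expMeasure one_pos
  let U : ℝ × (Fin d → ℝ) → Fin d → ℝ := fun p j => ψ (p.2 j / p.1)
  have hU : Measurable U := measurable_pi_lambda _ fun j => ψ_meas.comp (by fun_prop)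
  let P : Measure (ℝ × (Fin d → ℝ)) := G.prod (Measure.pi fun _ => expMeasure 1)
  have hPU : IsProbabilityMeasure (P.map U) := Measure.isProbabilityMeasure_map hU.aemeasurable
  refine isCopula_of_cdf (P.map U) ?_ (fun u hu => ?_) fun j a ha => ?_
  · rw [ae_map_iff hU.aemeasurable (by measurability)]
    exact ae_of_all _ fun p j => inv_mem _ (hmax _)
  · have hset : MeasurableSet {x : Fin d → ℝ | ∀ j, x j ≤ u j} := by
      simp only [ofPred_forall]
      exact MeasurableSet.iInter fun j => measurableSet_le (measurable_pi_apply j) measurable_const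
    rw [measureReal_def, Measure.map_apply hU hset]
    by_cases hz : ∃ j, u j = 0
    · obtain ⟨j, hj⟩ := hz
      have hempty : U ⁻¹' {x | ∀ j, x j ≤ u j} = ∅ := by
        refine eq_empty_of_forall_notMem fun p hp => ?_
        exact (ψ_pos _).not_ge (hj ▸ hp j)
      have htop : ∑ i, φ (u i) = ⊤ :=
        sum_eq_top_of_nonneg (fun i => hbij.mapsTo (hu i)) (j := j) (by rw [hj, h0])
      rw [hempty, measure_empty, ENNReal.toReal_zero, htop, ← h0, inv_φ 0 (by simp)]
    · have hu' : ∀ j, u j ∈ Ioc (0 : ℝ) 1 := fun j =>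
        ⟨(hu j).1.lt_of_ne fun h => hz ⟨j, h.symm⟩, (hu j).2⟩
      choose t ht hφt using fun j => φ_real (u j) (hu' j)
      have hsum : ∑ j, φ (u j) = ((∑ j, t j : ℝ) : EReal) := by
        simp only [hφt]
        exact (map_sum (⟨⟨Real.toEReal, EReal.coe_zero⟩, EReal.coe_add⟩ : ℝ →+ EReal)
          t _).symm
      have hmain : P (U ⁻¹' {x | ∀ j, x j ≤ u j}) = laplace G (∑ j, t j) := by
        rw [Measure.prod_apply (hU hset), laplace]
        refine lintegral_congr_ae ?_
        filter_upwards [hGpos] with m hm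
        have hfib : Prod.mk m ⁻¹' (U ⁻¹' {x | ∀ j, x j ≤ u j})
            = univ.pi fun j => {e | t j ≤ max (e / m) 0} := by
          ext e
          simp only [mem_preimage, mem_ofPred_eq, mem_univ_pi]
          refine forall_congr' fun j => ?_
          rw [ψ_le _ _ (hu j), hφt, EReal.coe_le_coe_iff]
        rw [hfib, Measure.pi_pi]
        simp only [expMeasure_one_setOf_le_max_div (ht _) hm]
        rw [← ENNReal.ofReal_prod_of_nonneg fun j _ => (Real.exp_pos _).le, ← Real.exp_sum,
          Finset.sum_neg_distrib, Finset.sum_mul]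
      have hnn : 0 ≤ ∑ j, t j := Finset.sum_nonneg fun j _ => ht j
      rw [hmain, hG _ hnn, hsum,
        ENNReal.toReal_ofReal (inv_mem _ (EReal.coe_nonneg.2 hnn)).1]
  · have hsum : ∑ i, φ (Function.update (fun _ : Fin d => (1 : ℝ)) j a i) = φ a := by
      rw [Finset.sum_eq_single j]
      · rw [Function.update_self]
      · intro i _ hij
        rw [Function.update_of_ne hij, h1]
      · exact fun h => absurd (Finset.mem_univ j) h
    rw [hsum, inv_φ a ha]

/-! ### The power-divergence generators -/

/-- Given that `φ_λ(y) = t` follows from `y = k * h` with `k` the Laplace transform of `K` at `t`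
and `h` the value at `y` of a probability generating function, the function `C_λ` is a copula. -/
theorem isCopula_powerDivCopula {lam : ℝ} (hl : lam ≤ -1)
    (hbij : BijOn (powerDiv lam) (Icc 0 1) (Ici 0))
    (hanti : AntitoneOn (powerDivFormula lam) (Ioc 0 1)) (K : Measure ℝ) [SFinite K]
    {k h : ℝ → ℝ} (hk : ∀ t, 0 ≤ t → laplace K t = ENNReal.ofReal (k t))
    (hk1 : ∀ t, 0 ≤ t → k t ∈ Icc (0 : ℝ) 1) {c : ℕ → ℝ≥0∞} (hc : ∑' n, c n = 1)
    (hh : ∀ y, 0 ≤ y → genFun c (ENNReal.ofReal y) = ENNReal.ofReal (h y))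
    (hhpos : ∀ y, 0 ≤ y → 0 ≤ h y)
    (heq : ∀ t y, 0 ≤ t → y ∈ Icc (0 : ℝ) 1 → y = k t * h y →
      0 < y ∧ powerDivFormula lam y = t) (d : ℕ) :
    IsCopula (fun u : Fin d → ℝ => powerDivCopula lam u) := by
  have hz : powerDiv lam 0 = ⊤ := by simp [powerDiv, hl]
  have hp : ∀ x : ℝ, 0 < x → powerDiv lam x = (powerDivFormula lam x : EReal) := by
    intro x hx
    simp [powerDiv, hx.ne']
  obtain ⟨G, hGs, hG⟩ := exists_laplace_eq_mul_genFun K hc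
  refine isCopula_of_laplace hbij ?_ hz G (fun t ht => ?_) d
  · intro x hx y hy hxy
    rcases hx.1.eq_or_lt with rfl | hx0
    · rw [hz]
      exact le_top
    · rw [hp x hx0, hp y (hx0.trans_le hxy), EReal.coe_le_coe_iff]
      exact hanti ⟨hx0, hx.2⟩ ⟨hx0.trans_le hxy, hy.2⟩ hxy
  · obtain ⟨hle, hfix⟩ := hG t (by
      rw [hk t ht, ← ENNReal.ofReal_one]
      exact ENNReal.ofReal_le_ofReal (hk1 t ht).2)
    set y := (laplace G t).toReal with hy
    have hGy : laplace G t = ENNReal.ofReal y :=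
      (ENNReal.ofReal_toReal (ne_top_of_le_ne_top ENNReal.one_ne_top hle)).symm
    have hy0 : 0 ≤ y := ENNReal.toReal_nonneg
    have hy1 : y ≤ 1 := ENNReal.toReal_le_of_le_ofReal zero_le_one (by simpa using hle)
    rw [hGy, hk t ht, hh y hy0, ← ENNReal.ofReal_mul (hk1 t ht).1,
      ENNReal.ofReal_eq_ofReal_iff hy0 (mul_nonneg (hk1 t ht).1 (hhpos y hy0))] at hfix
    obtain ⟨hypos, hyt⟩ := heq t y ht ⟨hy0, hy1⟩ hfix
    have hmem : (t : EReal) ∈ powerDiv lam '' Icc 0 1 := ⟨y, ⟨hy0, hy1⟩, by rw [hp y hypos, hyt]⟩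
    have hinv : Function.invFunOn (powerDiv lam) (Icc 0 1) (t : EReal) = y :=
      hbij.injOn (Function.invFunOn_mem hmem) ⟨hy0, hy1⟩
        ((Function.invFunOn_eq hmem).trans (by rw [hp y hypos, hyt]))
    rw [hinv, hGy]

/-- For `λ = -1` the inverse `y` of `φ_λ` at `t` solves `y = exp (-t) * exp (y - 1)`, whose last
factor is the generating function of the Poisson distribution of mean `1`. -/
theorem isCopula_powerDivCopula_neg_one (d : ℕ) :
    IsCopula (fun u : Fin d → ℝ => powerDivCopula (-1) u) := by
  have hf : ∀ x, powerDivFormula (-1) x = x - 1 - Real.log x := by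
    intro x; simp [powerDivFormula]
  have hgen : ∀ y, 0 ≤ y → genFun (fun n => ENNReal.ofReal (Real.exp (-1) / n.factorial))
      (ENNReal.ofReal y) = ENNReal.ofReal (Real.exp (y - 1)) := by
    intro y hy
    have hs : HasSum (fun n : ℕ => Real.exp (-1) / n.factorial * y ^ n) (Real.exp (y - 1)) := by
      have h := (NormedSpace.expSeries_div_hasSum_exp y).mul_left (Real.exp (-1))
      rw [← Real.exp_eq_exp_ℝ, ← Real.exp_add, neg_add_eq_sub] at h
      exact h.congr_fun fun n => by ring
    rw [← hs.tsum_eq, ENNReal.ofReal_tsum_of_nonneg (fun n => by positivity) hs.summable]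
    refine tsum_congr fun n => ?_
    rw [ENNReal.ofReal_mul (by positivity), ENNReal.ofReal_pow hy]
  refine isCopula_powerDivCopula le_rfl powerDiv_neg_one_bijOn ?_ (Measure.dirac 1)
    (k := fun t => Real.exp (-t)) (h := fun y => Real.exp (y - 1)) (fun t _ => laplace_dirac_one t)
    (fun t ht => ⟨(Real.exp_pos _).le, Real.exp_le_one_iff.2 (by linarith)⟩) ?_ hgen
    (fun y _ => (Real.exp_pos _).le) ?_ d
  · intro x hx y hy hxy
    simp only [hf]
    have h1 : Real.log (y / x) ≥ 1 - (y / x)⁻¹ :=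
      Real.one_sub_inv_le_log_of_pos (div_pos hy.1 hx.1)
    rw [Real.log_div hy.1.ne' hx.1.ne', inv_div] at h1
    have h2 : y - x ≤ 1 - x / y := by
      rw [show 1 - x / y = (y - x) / y by field_simp [hy.1.ne'], le_div_iff₀ hy.1]
      nlinarith [hy.2]
    linarith
  · simpa [genFun] using hgen 1 zero_le_one
  · intro t y _ _ hfix
    rw [← Real.exp_add] at hfix
    have hlog := congrArg Real.log hfix
    rw [Real.log_exp] at hlog
    refine ⟨hfix ▸ Real.exp_pos _, ?_⟩
    rw [hf]
    linarith

/-- For `λ = -2` the inverse `y` of `φ_λ` at `t` solves `y = (1 + t)⁻¹ * ((1 + y ^ 2) / 2)`, whose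
last factor is the generating function of a variable that is `0` or `2`, each with probability
`1 / 2`. -/
theorem isCopula_powerDivCopula_neg_two (d : ℕ) :
    IsCopula (fun u : Fin d → ℝ => powerDivCopula (-2) u) := by
  have hf : ∀ x, powerDivFormula (-2) x = (x⁻¹ + x - 2) / 2 := by
    intro x
    have h : ((-2 : ℝ) + 1) = -1 := by norm_num
    rw [powerDivFormula, if_neg (by norm_num), if_neg (by norm_num), h, Real.rpow_neg_one]
    ring
  have hE : IsProbabilityMeasure (expMeasure 1) := isProbabilityMeasure_expMeasure one_pos
  have hgen : ∀ y, 0 ≤ y → genFun (fun n => if n = 0 ∨ n = 2 then ENNReal.ofReal (1 / 2) else 0)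
      (ENNReal.ofReal y) = ENNReal.ofReal ((1 + y ^ 2) / 2) := by
    intro y hy
    rw [genFun, tsum_eq_sum (s := Finset.range 3)
      (fun n hn => by
        rw [Finset.mem_range] at hn
        rw [if_neg (by omega), zero_mul])]
    simp only [Finset.sum_range_succ, Finset.sum_range_zero]
    norm_num only [true_or, or_true, if_true, if_false, zero_mul, zero_add, add_zero, pow_zero,
      mul_one, or_self]
    rw [← ENNReal.ofReal_pow hy, ← ENNReal.ofReal_mul (by norm_num),
      ← ENNReal.ofReal_add (by norm_num) (by positivity)]
    ring_nf
  refine isCopula_powerDivCopula (by norm_num) powerDiv_neg_two_bijOn ?_ (expMeasure 1)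
    (k := fun t => 1 / (1 + t)) (h := fun y => (1 + y ^ 2) / 2) (fun t ht => laplace_expMeasure ht)
    (fun t ht => ⟨by positivity, div_le_one_of_le₀ (by linarith) (by linarith)⟩) ?_ hgen
    (fun y _ => by positivity) ?_ d
  · intro x hx y hy hxy
    simp only [hf]
    have h1 : y - x ≤ x⁻¹ - y⁻¹ := by
      rw [inv_sub_inv hx.1.ne' hy.1.ne', le_div_iff₀ (mul_pos hx.1 hy.1)]
      have : x * y ≤ 1 := mul_le_one₀ hx.2 hy.1.le hy.2
      nlinarith
    linarith
  · have h := hgen 1 zero_le_one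
    norm_num [genFun] at h ⊢
    exact h
  · intro t y ht _ hfix
    have ht1 : (0 : ℝ) < 1 + t := by linarith
    have hy : 0 < y := hfix ▸ by positivity
    refine ⟨hy, ?_⟩
    rw [hf]
    field_simp at hfix ⊢
    linarith

theorem mainTheorem5 (d : ℕ) (hd : 3 ≤ d) :
    IsCopula (fun u : Fin d → ℝ => powerDivCopula (-1) u) ∧
      IsCopula (fun u : Fin d → ℝ => powerDivCopula (-2) u) :=
  ⟨isCopula_powerDivCopula_neg_one d, isCopula_powerDivCopula_neg_two d⟩
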